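/- All graphs are finite and simple. A burning process of a graph $G$ proceeds in rounds: initially all vertices are unburned; in each round $r\ge 1$ one chooses a vertex $x_r$ that is still unburned (the source of round $r$) and burns $x_r$ together with all unburned vertices adjacent to a vertex burned in an earlier round. Burned vertices remain burned, and the process terminates once all vertices are burned. If it terminates in $k$ rounds, $(x_1,\dots,x_k)$ is called a burning sequence of length $k$ for $G$; the burning number $b(G)$ is the minimum length of a burning sequence for $G$. Let $G$ be a graph of order $n$. If $G$ has a spanning tree $T$ such that $T$ contains at most $\lfloor\sqrt{n-1}\rfloor$ vertices of degree $2$ (degree taken in $T$), then $b(G)\le\lceil\sqrt{n}\,\rceil$. -/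

import Mathlib

/-- The set of vertices of `G` that are burned at the end of round `r`, when `x i` is the source
of round `i + 1`: nothing is burned at the start, and in each round the source of that round and
all neighbours of the already burned vertices become burned; burned vertices stay burned. -/
def SimpleGraph.burnedAfter {V : Type*} (G : SimpleGraph V) {k : ℕ} (x : Fin k → V) : ℕ → Set V
  | 0 => ∅
  | r + 1 => {v | v ∈ G.burnedAfter x r ∨ (∃ u ∈ G.burnedAfter x r, G.Adj u v) ∨
      ∃ h : r < k, v = x ⟨r, h⟩}

/-- `x` is a burning sequence of length `k` for `G`: every source is unburned when it is chosen,
and all vertices are burned at the end of round `k`. Because the source of each round is unburned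
when it is chosen, the process cannot have terminated before round `k`. -/
structure SimpleGraph.IsBurningSequence {V : Type*} (G : SimpleGraph V) {k : ℕ} (x : Fin k → V) :
    Prop where
  source_unburned : ∀ i : Fin k, x i ∉ G.burnedAfter x i
  all_burned : G.burnedAfter x k = Set.univ

/-- The burning number of `G`: the minimum length of a burning sequence for `G`. -/
noncomputable def SimpleGraph.burningNumber {V : Type*} (G : SimpleGraph V) : ℕ :=
  sInf {k : ℕ | ∃ x : Fin k → V, G.IsBurningSequence x}

/-- The first rounds do not depend on a later source. -/
theorem SimpleGraph.burnedAfter_snoc {V : Type*} (G : SimpleGraph V) {k : ℕ} (x : Fin k → V)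
    (v : V) (r : ℕ) (hr : r ≤ k) :
    G.burnedAfter (Fin.snoc x v : Fin (k + 1) → V) r = G.burnedAfter x r := by
  induction r with
  | zero => rfl
  | succ r ih =>
    have hrk : r < k := hr
    have hx : (Fin.snoc x v : Fin (k + 1) → V) ⟨r, by omega⟩ = x ⟨r, hrk⟩ :=
      Fin.snoc_castSucc (α := fun _ => V) v x ⟨r, hrk⟩
    ext w
    simp only [SimpleGraph.burnedAfter, ih hrk.le, Set.mem_ofPred_eq, hx, hrk,
      Nat.lt_succ_of_lt hrk, exists_true_left]

/-- A finite graph has a burning sequence, so the minimum that defines the burning number is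
taken over a nonempty set. -/
theorem SimpleGraph.exists_isBurningSequence {V : Type*} [Finite V] (G : SimpleGraph V) :
    ∃ (k : ℕ) (x : Fin k → V), G.IsBurningSequence x := by
  by_contra hcon
  push Not at hcon
  have key : ∀ k : ℕ, ∃ x : Fin k → V, (∀ i : Fin k, x i ∉ G.burnedAfter x i) ∧
      k ≤ (G.burnedAfter x k).ncard := by
    intro k
    induction k with
    | zero => exact ⟨Fin.elim0, fun i => i.elim0, Nat.zero_le _⟩
    | succ k ih =>
      obtain ⟨x, hx, hk⟩ := ih
      have hne : G.burnedAfter x k ≠ Set.univ := fun h => hcon k x ⟨hx, h⟩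
      obtain ⟨v, hv⟩ := (Set.ne_univ_iff_exists_notMem _).1 hne
      have hlast : (Fin.snoc x v : Fin (k + 1) → V) ⟨k, Nat.lt_succ_self k⟩ = v :=
        Fin.snoc_last (α := fun _ => V) v x
      refine ⟨Fin.snoc x v, ?_, ?_⟩
      · intro i
        rw [SimpleGraph.burnedAfter_snoc G x v i (Nat.le_of_lt_succ i.2)]
        refine Fin.lastCases ?_ (fun j => ?_) i
        · simpa using hv
        · simpa using hx j
      · have hsub : insert v (G.burnedAfter x k) ⊆
            G.burnedAfter (Fin.snoc x v : Fin (k + 1) → V) (k + 1) := by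
          intro w hw
          rcases hw with rfl | hw
          · exact Or.inr (Or.inr ⟨Nat.lt_succ_self k, hlast.symm⟩)
          · exact Or.inl (by rwa [SimpleGraph.burnedAfter_snoc G x v k le_rfl])
        have h1 := Set.ncard_le_ncard hsub (Set.toFinite _)
        rw [Set.ncard_insert_of_notMem hv (Set.toFinite _)] at h1
        omega
  obtain ⟨x, -, hx⟩ := key (Nat.card V + 1)
  have := Set.ncard_le_card (G.burnedAfter x (Nat.card V + 1))
  omega

/-- On a finite graph the burning number is attained. -/
theorem SimpleGraph.isLeast_burningNumber {V : Type*} [Finite V] (G : SimpleGraph V) :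
    IsLeast {k : ℕ | ∃ x : Fin k → V, G.IsBurningSequence x} G.burningNumber :=
  ⟨Nat.sInf_mem G.exists_isBurningSequence, fun _ hk => Nat.sInf_le hk⟩

/-!
Reversing time, a graph is burned within `k` rounds as soon as it is covered by balls of radii
`0, 1, …, k - 1`: wasted sources can be replaced by unburned ones.

Root the tree `T` at a vertex which is not a leaf. The ball of radius `r` around the `r`-th ancestor
of a deepest vertex removes a whole subtree and at least `r + 1` vertices (or everything), and what
is left is closed under taking parents; if at most `2 * r + 1` vertices are left, the ball contains
all of them. So balls of radii `0, …, k - 2` cover any parent-closed set of at most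
`k * (k + 1) / 2 - 2` vertices. Since `T` has few vertices of degree two, the non-leaves form such
a set, and increasing all radii by one covers the leaves as well.
-/

namespace GraphBurning

open Finset

variable {V : Type*} {G T : SimpleGraph V}

section Burning

variable {k : ℕ}

theorem mem_burnedAfter_add_length {x : Fin k → V} {u v : V} (w : G.Walk u v) {r : ℕ}
    (hu : u ∈ G.burnedAfter x r) : v ∈ G.burnedAfter x (r + w.length) := by
  induction w generalizing r with
  | nil => exact hu
  | cons huv w ih =>
    rw [SimpleGraph.Walk.length_cons, add_comm w.length, ← add_assoc]
    exact ih (Or.inr (Or.inl ⟨_, hu, huv⟩))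

theorem burnedAfter_monotone (x : Fin k → V) : Monotone (G.burnedAfter x) :=
  monotone_nat_of_le_succ fun _ _ hv => Or.inl hv

theorem mem_burnedAfter_add_of_edist_le {x : Fin k → V} {u v : V} {r i : ℕ}
    (hu : u ∈ G.burnedAfter x r) (huv : G.edist u v ≤ i) : v ∈ G.burnedAfter x (r + i) := by
  obtain ⟨w, hw⟩ := SimpleGraph.exists_walk_of_edist_ne_top (ne_top_of_le_ne_top (by simp) huv)
  have hwi : w.length ≤ i := by exact_mod_cast hw.trans_le huv
  exact burnedAfter_monotone x (by gcongr) (mem_burnedAfter_add_length w hu)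

theorem burnedAfter_subset_of_le (h : T ≤ G) (x : Fin k → V) (r : ℕ) :
    T.burnedAfter x r ⊆ G.burnedAfter x r := by
  induction r with
  | zero => exact subset_rfl
  | succ r ih =>
    rintro v (hv | ⟨u, hu, huv⟩ | hv)
    · exact Or.inl (ih hv)
    · exact Or.inr (Or.inl ⟨u, ih hu, h huv⟩)
    · exact Or.inr (Or.inr hv)

theorem burnedAfter_snoc_succ (x : Fin k → V) (v : V) :
    G.burnedAfter (Fin.snoc x v : Fin (k + 1) → V) (k + 1) =
      {w | w ∈ G.burnedAfter x k ∨ (∃ u ∈ G.burnedAfter x k, G.Adj u w) ∨ w = v} := by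
  have hlast : (Fin.snoc x v : Fin (k + 1) → V) ⟨k, k.lt_succ_self⟩ = v :=
    Fin.snoc_last (α := fun _ => V) v x
  ext w
  simp only [SimpleGraph.burnedAfter, G.burnedAfter_snoc x v k le_rfl, hlast, k.lt_succ_self,
    exists_true_left]

theorem source_unburned_snoc {x : Fin k → V} (hx : ∀ i : Fin k, x i ∉ G.burnedAfter x i) {v : V}
    (hv : v ∉ G.burnedAfter x k) (i : Fin (k + 1)) :
    (Fin.snoc x v : Fin (k + 1) → V) i ∉ G.burnedAfter (Fin.snoc x v : Fin (k + 1) → V) i := by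
  rw [G.burnedAfter_snoc x v i (Nat.le_of_lt_succ i.2)]
  refine Fin.lastCases ?_ (fun j => ?_) i
  · simpa using hv
  · simpa using hx j

theorem burningNumber_le_of_isBurningSequence {x : Fin k → V} (hx : G.IsBurningSequence x) :
    G.burningNumber ≤ k :=
  Nat.sInf_le ⟨x, hx⟩

theorem burningNumber_le_or_exists_burnedAfter_subset (x : Fin k → V) :
    G.burningNumber ≤ k ∨ ∃ y : Fin k → V, (∀ i : Fin k, y i ∉ G.burnedAfter y i) ∧
      G.burnedAfter x k ⊆ G.burnedAfter y k := by
  induction x using Fin.snocInduction with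
  | elim0 => exact Or.inr ⟨Fin.elim0, fun i => i.elim0, subset_rfl⟩
  | @snoc k x a ih =>
    obtain hle | ⟨y, hy, hxy⟩ := ih
    · exact Or.inl (hle.trans k.le_succ)
    by_cases huniv : G.burnedAfter y k = Set.univ
    · exact Or.inl ((burningNumber_le_of_isBurningSequence ⟨hy, huniv⟩).trans k.le_succ)
    obtain ⟨b, hb, hab⟩ : ∃ b ∉ G.burnedAfter y k, a ∈ G.burnedAfter y k ∨ a = b := by
      by_cases ha : a ∈ G.burnedAfter y k
      · obtain ⟨b, hb⟩ := (Set.ne_univ_iff_exists_notMem _).1 huniv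
        exact ⟨b, hb, Or.inl ha⟩
      · exact ⟨a, ha, Or.inr rfl⟩
    refine Or.inr ⟨Fin.snoc y b, source_unburned_snoc hy hb, ?_⟩
    rw [burnedAfter_snoc_succ, burnedAfter_snoc_succ]
    rintro w (hw | ⟨u, hu, huw⟩ | rfl)
    · exact Or.inl (hxy hw)
    · exact Or.inr (Or.inl ⟨u, hxy hu, huw⟩)
    · exact hab.imp_right Or.inr

theorem burningNumber_le_of_burnedAfter_eq_univ {x : Fin k → V}
    (hx : G.burnedAfter x k = Set.univ) : G.burningNumber ≤ k := by
  obtain hle | ⟨y, hy, hxy⟩ := burningNumber_le_or_exists_burnedAfter_subset (G := G) x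
  · exact hle
  · exact burningNumber_le_of_isBurningSequence ⟨hy, Set.univ_subset_iff.1 (hx ▸ hxy)⟩

theorem burningNumber_le_of_forall_exists_edist_le (c : Fin k → V)
    (hc : ∀ v, ∃ i, G.edist (c i) v ≤ (i : ℕ)) : G.burningNumber ≤ k := by
  refine burningNumber_le_of_burnedAfter_eq_univ (x := fun i => c i.rev)
    (Set.eq_univ_of_forall fun v => ?_)
  obtain ⟨i, hi⟩ := hc v
  have hsource : c i ∈ G.burnedAfter (fun i => c i.rev) (i.rev + 1) :=
    Or.inr (Or.inr ⟨i.rev.2, congrArg c i.rev_rev.symm⟩)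
  have hround : (i.rev : ℕ) + 1 + i = k := by rw [Fin.val_rev]; omega
  rw [← congrArg (G.burnedAfter fun i => c i.rev) hround]
  exact mem_burnedAfter_add_of_edist_le hsource hi

theorem burningNumber_le_card [Fintype V] (G : SimpleGraph V) :
    G.burningNumber ≤ Fintype.card V :=
  burningNumber_le_of_forall_exists_edist_le (Fintype.equivFin V).symm fun v =>
    ⟨Fintype.equivFin V v, by simp⟩

theorem burningNumber_le_of_le [Finite V] (h : T ≤ G) : G.burningNumber ≤ T.burningNumber := by
  obtain ⟨x, hx⟩ := T.isLeast_burningNumber.1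
  exact burningNumber_le_of_burnedAfter_eq_univ
    (Set.univ_subset_iff.1 (hx.all_burned ▸ burnedAfter_subset_of_le h x _))

end Burning

/-- `p` is the parent map of a breadth-first spanning tree of `T` with root `ρ`; the root is its own
parent, so that `p` can be iterated freely. The depth of a vertex is its distance from `ρ`. -/
structure IsParentMap (T : SimpleGraph V) (ρ : V) (p : V → V) : Prop where
  parent_root : p ρ = ρ
  adj_parent : ∀ v ≠ ρ, T.Adj v (p v)
  dist_parent_add_one : ∀ v ≠ ρ, T.dist ρ (p v) + 1 = T.dist ρ v

theorem exists_isParentMap (hT : T.Connected) (ρ : V) : ∃ p, IsParentMap T ρ p := by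
  have hstep (v : V) : ∃ u, (v = ρ → u = ρ) ∧
      (v ≠ ρ → T.Adj v u ∧ T.dist ρ u + 1 = T.dist ρ v) := by
    obtain ⟨w, hw⟩ := hT.exists_walk_length_eq_dist v ρ
    cases w with
    | nil => exact ⟨ρ, by simp⟩
    | @cons _ u _ hvu w =>
      have hu := SimpleGraph.dist_le w
      have hvρ : v ≠ ρ := by rintro rfl; simp at hw
      have hdiff := hvu.diff_dist_adj (u := ρ)
      rw [SimpleGraph.Walk.length_cons, SimpleGraph.dist_comm] at hw
      rw [SimpleGraph.dist_comm] at hu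
      exact ⟨u, fun h => absurd h hvρ, fun _ => ⟨hvu, by omega⟩⟩
  choose p hroot hp using hstep
  exact ⟨p, hroot ρ rfl, fun v hv => (hp v hv).1, fun v hv => (hp v hv).2⟩

/-- The first `n` vertices `v, p v, p (p v), …` on the way from `v` to the root of a parent map
`p`. -/
def ancestors [DecidableEq V] (p : V → V) (v : V) (n : ℕ) : Finset V :=
  (range n).image fun i => p^[i] v

theorem mem_ancestors [DecidableEq V] {p : V → V} {u v : V} {n : ℕ} :
    u ∈ ancestors p v n ↔ ∃ i < n, p^[i] v = u := by
  simp [ancestors]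

theorem ancestors_subset [DecidableEq V] {p : V → V} {A : Finset V} (hA : Set.MapsTo p A A) {v : V}
    (hv : v ∈ A) (n : ℕ) : ancestors p v n ⊆ A := by
  intro u hu
  obtain ⟨i, -, rfl⟩ := mem_ancestors.1 hu
  exact hA.iterate i hv

namespace IsParentMap

variable {ρ : V} {p : V → V}

theorem dist_parent (hp : IsParentMap T ρ p) (v : V) : T.dist ρ (p v) = T.dist ρ v - 1 := by
  obtain rfl | hv := eq_or_ne v ρ
  · simp [hp.parent_root]
  · exact Nat.eq_sub_of_add_eq (hp.dist_parent_add_one v hv)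

theorem dist_iterate (hp : IsParentMap T ρ p) (i : ℕ) (v : V) :
    T.dist ρ (p^[i] v) = T.dist ρ v - i := by
  induction i with
  | zero => rfl
  | succ i ih => rw [Function.iterate_succ_apply', hp.dist_parent, ih, Nat.sub_sub]

theorem eq_root_of_dist_eq_zero (hp : IsParentMap T ρ p) {v : V} (hv : T.dist ρ v = 0) :
    v = ρ := by
  by_contra hne
  exact absurd (hp.dist_parent_add_one v hne) (by omega)

theorem iterate_eq_root (hp : IsParentMap T ρ p) {v : V} {i : ℕ} (hi : T.dist ρ v ≤ i) :
    p^[i] v = ρ :=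
  hp.eq_root_of_dist_eq_zero (by rw [hp.dist_iterate]; omega)

theorem edist_parent_le_one (hp : IsParentMap T ρ p) (v : V) : T.edist v (p v) ≤ 1 := by
  obtain rfl | hv := eq_or_ne v ρ
  · simp [hp.parent_root]
  · exact (SimpleGraph.edist_eq_one_iff_adj.2 (hp.adj_parent v hv)).le

theorem edist_iterate_le (hp : IsParentMap T ρ p) (i : ℕ) (v : V) : T.edist v (p^[i] v) ≤ i := by
  induction i with
  | zero => simp
  | succ i ih =>
    rw [Function.iterate_succ_apply', Nat.cast_succ]
    exact SimpleGraph.edist_triangle.trans (add_le_add ih (hp.edist_parent_le_one _))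

theorem edist_le_of_iterate_eq_iterate (hp : IsParentMap T ρ p) {a b : ℕ} {u v : V}
    (h : p^[a] u = p^[b] v) : T.edist u v ≤ (a + b : ℕ) := by
  rw [Nat.cast_add]
  refine SimpleGraph.edist_triangle.trans (add_le_add (hp.edist_iterate_le a u) ?_)
  rw [h, SimpleGraph.edist_comm]
  exact hp.edist_iterate_le b v

theorem iterate_dist_sub_dist (hp : IsParentMap T ρ p) {u c : V} {j : ℕ} (h : p^[j] u = c) :
    p^[T.dist ρ u - T.dist ρ c] u = c := by
  have hc : T.dist ρ c = T.dist ρ u - j := h ▸ hp.dist_iterate j u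
  obtain hj | hj := le_total j (T.dist ρ u)
  · rwa [hc, Nat.sub_sub_self hj]
  · rw [hc, Nat.sub_eq_zero_of_le hj, Nat.sub_zero, hp.iterate_eq_root le_rfl, ← h,
      hp.iterate_eq_root hj]

theorem card_ancestors [DecidableEq V] (hp : IsParentMap T ρ p) {v : V} {n : ℕ}
    (hn : n ≤ T.dist ρ v + 1) : #(ancestors p v n) = n := by
  rw [ancestors, card_image_of_injOn, card_range]
  intro i hi j hj hij
  have hdist := congrArg (T.dist ρ) hij
  simp only [hp.dist_iterate, coe_range, Set.mem_Iio] at hdist hi hj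
  omega

theorem exists_card_le_sub_of_mapsTo (hp : IsParentMap T ρ p) {A : Finset V}
    (hA : Set.MapsTo p A A) (r : ℕ) :
    ∃ (c : V) (B : Finset V), Set.MapsTo p B B ∧ #B ≤ #A - (r + 1) ∧
      ∀ u ∈ A, u ∉ B → T.edist c u ≤ r := by
  classical
  obtain rfl | hne := A.eq_empty_or_nonempty
  · exact ⟨ρ, ∅, by simp, by simp, by simp⟩
  obtain ⟨v, hv, hdeepest⟩ := A.exists_max_image (T.dist ρ) hne
  set c := p^[r] v
  have hdist : T.dist ρ c = T.dist ρ v - r := hp.dist_iterate r v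
  refine ⟨c, {u ∈ A | ¬ ∃ j, p^[j] u = c}, fun u hu => ?_, ?_, fun u hu huB => ?_⟩
  · obtain ⟨huA, hu⟩ := mem_filter.1 hu
    exact mem_filter.2 ⟨hA huA, fun ⟨j, hj⟩ => hu ⟨j + 1, hj⟩⟩
  · have hsplit := card_filter_add_card_filter_not (s := A) fun u => ∃ j, p^[j] u = c
    obtain hr | hr := le_or_gt r (T.dist ρ v)
    · have hsub : ancestors p v (r + 1) ⊆ {u ∈ A | ∃ j, p^[j] u = c} := by
        intro u hu
        refine mem_filter.2 ⟨ancestors_subset hA hv _ hu, ?_⟩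
        obtain ⟨i, hi, rfl⟩ := mem_ancestors.1 hu
        exact ⟨r - i, by rw [← Function.iterate_add_apply, Nat.sub_add_cancel (by omega)]⟩
      have hcard := card_le_card hsub
      rw [hp.card_ancestors (by omega)] at hcard
      omega
    · have hroot : c = ρ := hp.iterate_eq_root hr.le
      have hall (u : V) : ∃ j, p^[j] u = c := ⟨_, hroot ▸ hp.iterate_eq_root le_rfl⟩
      simp [hall]
  · obtain ⟨j, hj⟩ : ∃ j, p^[j] u = c := by simpa [hu] using huB
    have hdu := hdeepest u hu
    rw [SimpleGraph.edist_comm, ← hp.iterate_dist_sub_dist hj]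
    exact (hp.edist_iterate_le _ u).trans (by exact_mod_cast (by omega))

theorem exists_iterate_eq_iterate_of_mapsTo (hp : IsParentMap T ρ p) {A : Finset V}
    (hA : Set.MapsTo p A A) {u v : V} (hu : u ∈ A) (hv : v ∈ A) :
    ∃ i ≤ T.dist ρ v, ∃ j ≤ T.dist ρ u, p^[i] v = p^[j] u ∧ T.dist ρ v + 1 + j ≤ #A := by
  classical
  have hroot : p^[T.dist ρ u] u ∈ ancestors p v (T.dist ρ v + 1) :=
    mem_ancestors.2 ⟨T.dist ρ v, by omega, by
      rw [hp.iterate_eq_root le_rfl, hp.iterate_eq_root le_rfl]⟩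
  have hmeet : ∃ j, p^[j] u ∈ ancestors p v (T.dist ρ v + 1) := ⟨_, hroot⟩
  have hle : Nat.find hmeet ≤ T.dist ρ u := Nat.find_min' hmeet hroot
  obtain ⟨i, hi, hij⟩ := mem_ancestors.1 (Nat.find_spec hmeet)
  have hdisj : Disjoint (ancestors p v (T.dist ρ v + 1)) (ancestors p u (Nat.find hmeet)) := by
    refine disjoint_right.2 fun w hw => ?_
    obtain ⟨l, hl, rfl⟩ := mem_ancestors.1 hw
    exact Nat.find_min hmeet hl
  refine ⟨i, Nat.le_of_lt_succ hi, _, hle, hij, ?_⟩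
  have hcard := card_le_card (union_subset (ancestors_subset hA hv (T.dist ρ v + 1))
    (ancestors_subset hA hu (Nat.find hmeet)))
  rwa [card_union_of_disjoint hdisj, hp.card_ancestors le_rfl, hp.card_ancestors (by omega)]
    at hcard

theorem exists_forall_edist_le_of_card_le (hp : IsParentMap T ρ p) {A : Finset V}
    (hA : Set.MapsTo p A A) {r : ℕ} (hcard : #A ≤ 2 * r + 1) : ∃ c, ∀ u ∈ A, T.edist c u ≤ r := by
  obtain rfl | hne := A.eq_empty_or_nonempty
  · exact ⟨ρ, by simp⟩
  obtain ⟨v, hv, hdeepest⟩ := A.exists_max_image (T.dist ρ) hne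
  refine ⟨p^[r] v, fun u hu => ?_⟩
  have hdu := hdeepest u hu
  obtain ⟨i, hi, j, hj, hij, hpath⟩ := hp.exists_iterate_eq_iterate_of_mapsTo hA hu hv
  have hdist := congrArg (T.dist ρ) hij
  rw [hp.dist_iterate, hp.dist_iterate] at hdist
  -- The centre lies on the path from `v` to `u`, below or above its turning point `p^[i] v`.
  obtain hri | hir := le_total r i
  · have hmeet : p^[i - r] (p^[r] v) = p^[j] u := by
      rw [← Function.iterate_add_apply, Nat.sub_add_cancel hri, hij]
    exact (hp.edist_le_of_iterate_eq_iterate hmeet).trans (by exact_mod_cast (by omega))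
  · have hmeet : p^[0] (p^[r] v) = p^[r - i + j] u := by
      rw [Function.iterate_zero_apply, Function.iterate_add_apply, ← hij,
        ← Function.iterate_add_apply, Nat.sub_add_cancel hir]
    exact (hp.edist_le_of_iterate_eq_iterate hmeet).trans (by exact_mod_cast (by omega))

theorem exists_forall_exists_edist_le (hp : IsParentMap T ρ p) {ι : Type*} [DecidableEq ι]
    (f : ι → ℕ) {i₀ : ι} {s : Finset ι} (hi₀ : i₀ ∉ s) {A : Finset V} (hA : Set.MapsTo p A A)
    (hcard : #A ≤ ∑ i ∈ s, (f i + 1) + (2 * f i₀ + 1)) :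
    ∃ c : ι → V, ∀ u ∈ A, ∃ i ∈ insert i₀ s, T.edist (c i) u ≤ f i := by
  induction s using Finset.induction_on generalizing A with
  | empty =>
    obtain ⟨c, hc⟩ := hp.exists_forall_edist_le_of_card_le hA (by simpa using hcard)
    exact ⟨fun _ => c, fun u hu => ⟨i₀, mem_insert_self _ _, hc u hu⟩⟩
  | insert j s hj ih =>
    obtain ⟨a, B, hB, hBcard, ha⟩ := hp.exists_card_le_sub_of_mapsTo hA (f j)
    rw [sum_insert hj] at hcard
    rw [mem_insert, not_or] at hi₀
    obtain ⟨c, hc⟩ := ih hi₀.2 hB (by omega)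
    refine ⟨Function.update c j a, fun u hu => ?_⟩
    by_cases huB : u ∈ B
    · obtain ⟨i, hi, hiu⟩ := hc u huB
      have hij : i ≠ j := by
        rintro rfl
        exact (mem_insert.1 hi).elim (fun h => hi₀.1 h.symm) hj
      exact ⟨i, insert_subset_insert _ (subset_insert _ _) hi,
        by rwa [Function.update_of_ne hij]⟩
    · exact ⟨j, by simp, by simpa using ha u hu huB⟩

theorem degree_parent_ne_one [T.LocallyFinite] (hp : IsParentMap T ρ p) (hρ : T.degree ρ ≠ 1)
    (v : V) : T.degree (p v) ≠ 1 := by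
  intro hleaf
  have hpv : p v ≠ ρ := fun h => hρ (h ▸ hleaf)
  have hv : v ≠ ρ := fun h => hpv (h ▸ hp.parent_root)
  have hunique : v = p (p v) :=
    (SimpleGraph.degree_eq_one_iff_existsUnique_adj.1 hleaf).unique (hp.adj_parent v hv).symm
      (hp.adj_parent _ hpv)
  have h₁ := hp.dist_parent_add_one v hv
  have h₂ := hp.dist_parent_add_one _ hpv
  rw [← hunique] at h₂
  omega

end IsParentMap

section Degree

variable [Fintype V] [DecidableRel T.Adj]

theorem burningNumber_le_of_card_degree_ne_one_le (hT : T.Connected) {ρ : V} (hρ : T.degree ρ ≠ 1)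
    {s : ℕ} (hcard : #{v | T.degree v ≠ 1} ≤ ∑ i ∈ range s, (i + 1) + (2 * s + 1)) :
    T.burningNumber ≤ s + 2 := by
  obtain ⟨p, hp⟩ := exists_isParentMap hT ρ
  have hinternal (v : V) : p v ∈ ({v | T.degree v ≠ 1} : Finset V) := by
    simpa using hp.degree_parent_ne_one hρ v
  obtain ⟨c, hc⟩ := hp.exists_forall_exists_edist_le id (notMem_range_self (n := s))
    (fun v _ => hinternal v) hcard
  refine burningNumber_le_of_forall_exists_edist_le (Fin.cons ρ fun i : Fin (s + 1) => c i)
    fun v => ?_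
  obtain ⟨i, hi, hiv⟩ := hc (p v) (hinternal v)
  rw [← range_add_one, mem_range] at hi
  refine ⟨Fin.succ ⟨i, hi⟩, ?_⟩
  rw [Fin.cons_succ, Fin.val_succ, Nat.cast_succ]
  refine SimpleGraph.edist_triangle.trans (add_le_add hiv ?_)
  rw [SimpleGraph.edist_comm]
  exact hp.edist_parent_le_one v

theorem exists_degree_ne_one_of_isTree (hT : T.IsTree) (hV : Fintype.card V ≠ 2) :
    ∃ v, T.degree v ≠ 1 := by
  classical
  by_contra! hleaf
  have hsum := T.sum_degrees_eq_twice_card_edges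
  have hedges := hT.card_edgeFinset
  simp only [hleaf, sum_const, card_univ, smul_eq_mul, mul_one] at hsum
  omega

theorem two_mul_card_degree_ne_one_add_two_le [Nontrivial V] (hT : T.IsTree) :
    2 * #{v | T.degree v ≠ 1} + 2 ≤ Fintype.card V + #{v | T.degree v = 2} := by
  classical
  -- Summed over `v`, this is the claim, since the degrees sum to `2 * (|V| - 1)`.
  have hpointwise (v : V) : 2 * (if T.degree v ≠ 1 then 1 else 0) + 1 ≤
      T.degree v + if T.degree v = 2 then 1 else 0 := by
    have := hT.connected.preconnected.degree_pos_of_nontrivial v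
    split_ifs <;> omega
  have hsum := sum_le_sum fun v (_ : v ∈ univ) => hpointwise v
  have hedges := hT.card_edgeFinset
  simp only [sum_add_distrib, ← mul_sum, ← card_filter, T.sum_degrees_eq_twice_card_edges,
    sum_const, card_univ, smul_eq_mul, mul_one] at hsum
  omega

end Degree

theorem add_floor_sqrt_sub_one_lt {n : ℕ} (hn : 0 < n) :
    n + ⌊√((n : ℝ) - 1)⌋₊ < ⌈√(n : ℝ)⌉₊ * (⌈√(n : ℝ)⌉₊ + 1) := by
  have hone : (1 : ℝ) ≤ n := by exact_mod_cast hn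
  have hceil := Nat.le_ceil √(n : ℝ)
  have hsq : n ≤ ⌈√(n : ℝ)⌉₊ ^ 2 := by exact_mod_cast (Real.sqrt_le_left (by positivity)).1 hceil
  have hfloor : ⌊√((n : ℝ) - 1)⌋₊ < ⌈√(n : ℝ)⌉₊ :=
    (Nat.floor_lt (Real.sqrt_nonneg _)).2
      ((Real.sqrt_lt_sqrt (by linarith) (by linarith)).trans_le hceil)
  linarith

end GraphBurning

open GraphBurning in
theorem mainTheorem5_general {V : Type*} [Fintype V] (G T : SimpleGraph V) [DecidableRel T.Adj]
    (hTG : T ≤ G) (hT : T.IsTree) (k : ℕ)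
    (hk : Fintype.card V + (Finset.univ.filter fun v : V => T.degree v = 2).card < k * (k + 1)) :
    G.burningNumber ≤ k := by
  obtain hV | hV := le_or_gt (Fintype.card V) 2
  · exact (burningNumber_le_card G).trans (by nlinarith)
  have : Nontrivial V := Fintype.one_lt_card_iff_nontrivial.1 (by omega)
  obtain ⟨s, rfl⟩ : ∃ s, k = s + 2 := Nat.exists_eq_add_of_le' (by nlinarith)
  obtain ⟨ρ, hρ⟩ := exists_degree_ne_one_of_isTree hT hV.ne'
  have hinternal := two_mul_card_degree_ne_one_add_two_le hT
  have hgauss : (∑ i ∈ Finset.range s, (i + 1)) * 2 = s * (s + 1) := by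
    simpa [Finset.sum_range_succ', mul_comm] using Finset.sum_range_id_mul_two (s + 1)
  exact (burningNumber_le_of_le hTG).trans
    (burningNumber_le_of_card_degree_ne_one_le hT.connected hρ (by linarith))

theorem mainTheorem5 {V : Type*} [Fintype V] (G : SimpleGraph V) (n : ℕ)
    (hn : Fintype.card V = n)
    (T : SimpleGraph V) [DecidableRel T.Adj] (hTG : T ≤ G) (hT : T.IsTree)
    (hdeg : (Finset.univ.filter (fun v : V => T.degree v = 2)).card ≤ ⌊√((n : ℝ) - 1)⌋₊) :
    G.burningNumber ≤ ⌈√(n : ℝ)⌉₊ := by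
  have hpos : 0 < n := hn ▸ Fintype.card_pos_iff.2 hT.connected.nonempty
  exact mainTheorem5_general G T hTG hT _
    ((add_le_add hn.le hdeg).trans_lt (GraphBurning.add_floor_sqrt_sub_one_lt hpos))
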